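/- Let $\Phi_a\subset\mathbb{R}^2$ (the APs) be a homogeneous Poisson point process of density $\lambda_a>0$, let $\lambda_u>0$ be the density of the UEs, let $o$ be the origin, and let $x^*\triangleq\arg\min_{x\in\Phi_a}|x|$ be the (almost surely unique) point of $\Phi_a$ closest to $o$, with Voronoi cell $\mathcal{V}^*=\{y\in\mathbb{R}^2:|y-x^*|<|y-x|\text{ for all }x\in\Phi_a\setminus\{x^*\}\}$. For $x\in\mathbb{R}^2$ let $p_c(x\mid x^*)=\mathbb{P}(x\in\mathcal{V}^*\mid x^*)$ be the conditional probability that $x$ lies in $\mathcal{V}^*$ given the position of $x^*$, that is, the limit as $\varepsilon\downarrow0$ of the conditional probability given that the closest point lies in the open disc of radius $\varepsilon$ about the given position (this limit exists for every $x$). For a receiver position $x_R\in\mathbb{R}^2$ define the equivalent UE density $$\lambda_{x_R,u}(r)=\lambda_u\left(1-\frac1{2\pi}\int_0^{2\pi}p_c\big((r\cos\theta,r\sin\theta)+x_R\mid x^*\big)\,d\theta\right),\qquad r\ge0,$$ in which the integrand is integrable. Then for every given position $x^*\neq o$ and every $x_R$ strictly inside the line segment from $o$ to $x^*$ (that is,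 $|x_R|\in(0,|x^*|)$, with the angular coordinate of $x_R$ equal to that of $x^*$), $$\lambda_{x_R,u}(r)=\lambda_u\lambda_a\,\frac{8}{9\pi}\,\frac{(|x^*|/|x_R|)^2}{|x^*|-|x_R|}\,r^3+\mathcal{O}(r^4),\qquad r\to0,$$ where the constant in $\mathcal{O}$ may depend on $\lambda_a,\lambda_u,x^*,x_R$. In particular $\lambda_{x_R,u}(r)$ is of exact order $r^3$ as $r\to0$. -/

import Mathlib

open MeasureTheory ProbabilityTheory Filter Topology Asymptotics Set

/-- The plane `ℝ²` with the Euclidean norm; its volume is the Lebesgue measure (area). -/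
abbrev Plane : Type := EuclideanSpace ℝ (Fin 2)

/-- `Φ` is a homogeneous Poisson point process of density `lam` in the plane, on the probability
space `(Ω, P)`: a random locally finite set, whose numbers of points in bounded Borel sets `B` are
random variables with Poisson law of mean `lam * |B|`, independent for disjoint sets. -/
structure IsHomogeneousPPP {Ω : Type*} [MeasurableSpace Ω] (P : Measure Ω) (Φ : Ω → Set Plane)
    (lam : ℝ) : Prop where
  locallyFinite : ∀ ω, ∀ B : Set Plane, Bornology.IsBounded B → (Φ ω ∩ B).Finite
  measurable_count : ∀ B : Set Plane, MeasurableSet B → Bornology.IsBounded B →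
    Measurable fun ω => (Φ ω ∩ B).ncard
  map_count : ∀ B : Set Plane, MeasurableSet B → Bornology.IsBounded B →
    P.map (fun ω => (Φ ω ∩ B).ncard) = poissonMeasure (Real.toNNReal (lam * volume.real B))
  indep_count : ∀ (n : ℕ) (B : Fin n → Set Plane), (∀ i, MeasurableSet (B i)) →
    (∀ i, Bornology.IsBounded (B i)) → Pairwise (fun i j => Disjoint (B i) (B j)) →
    iIndepFun (fun i ω => (Φ ω ∩ B i).ncard) P

/-- `z` is a point of the configuration `S` that is closest to the origin. -/
def IsNearestToOrigin (S : Set Plane) (z : Plane) : Prop :=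
  z ∈ S ∧ ∀ w ∈ S, ‖z‖ ≤ ‖w‖

/-- The (open) Voronoi cell of `z` generated by the configuration `S`. -/
def voronoiCell (S : Set Plane) (z : Plane) : Set Plane :=
  {y | ∀ w ∈ S \ {z}, dist y z < dist y w}

/-- The conditional probability that `x` lies in the Voronoi cell of the nearest point to the
origin, given that this nearest point lies in the disc of radius `ε` about `xs`. (The nearest point
is almost surely unique, and the conditioning event has positive probability if `0 < ε`.) -/
noncomputable def cellProbNear {Ω : Type*} [MeasurableSpace Ω] (P : Measure Ω) (Φ : Ω → Set Plane)
    (xs x : Plane) (ε : ℝ) : ℝ :=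
  P.real {ω | ∃ z ∈ Metric.ball xs ε, IsNearestToOrigin (Φ ω) z ∧ x ∈ voronoiCell (Φ ω) z} /
    P.real {ω | ∃ z ∈ Metric.ball xs ε, IsNearestToOrigin (Φ ω) z}

/-- The probabilistic cell area function `p_c(x ∣ xs)`: the conditional probability that `x` lies in
the Voronoi cell of the nearest point to the origin, given that this nearest point is at `xs`.
As that event is null, it is conditioned on through shrinking discs about `xs`. -/
noncomputable def cellProb {Ω : Type*} [MeasurableSpace Ω] (P : Measure Ω) (Φ : Ω → Set Plane)
    (xs x : Plane) : ℝ :=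
  limUnder (𝓝[>] (0 : ℝ)) (cellProbNear P Φ xs x)

/-- The point of the plane with polar coordinates `(r, θ)`. -/
noncomputable def polarPoint (r θ : ℝ) : Plane := !₂[r * Real.cos θ, r * Real.sin θ]

/-- The equivalent density `r ↦ λ_{xR,u}(r)` of the interfering UEs seen from a receiver at `xR`,
given that the nearest AP to the origin is at `xs`; `lamu` is the density of the UEs. -/
noncomputable def equivalentDensity {Ω : Type*} [MeasurableSpace Ω] (P : Measure Ω)
    (Φ : Ω → Set Plane) (lamu : ℝ) (xs xR : Plane) (r : ℝ) : ℝ :=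
  lamu * (1 - 1 / (2 * Real.pi) *
    ∫ θ in (0 : ℝ)..(2 * Real.pi), cellProb P Φ xs (polarPoint r θ + xR))

/-! Given the nearest point at `xs`, the disc about `0` through `xs` is empty, and `x` lies in the
cell of `xs` when the disc about `x` through `xs` is empty too. So `cellProb` at `x` is `exp (-lam *
A)`, where `A` is the area of the lune that the second disc adds to the first. Conditioning on a
null event is made rigorous by sandwiching numerator and denominator of `cellProbNear` between
counting events of disjoint regions (`tendsto_prob_div_of_sandwich`): each is asymptotic to `lam *
|ball xs ε|` times a void probability, and the prefactor cancels.

The two circles meet at `xs` and at its mirror image in the line through `0` and `x`. With `h` the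
half-length of this common chord, `d = dist x xs` and `R = ‖xs‖`, the lune is thin and has area `2/3
* (1/d - 1/R) * h^3 + O(h^5)`. For `x = xR + e` with `xR` on the segment, `h = |xs × e| / ‖x‖`,
because `xs × xR = 0`. Hence the area is cubic in `e`, linearising the exponential costs only
`O(‖e‖^6)`, and the mean of `|sin|^3` over the circle supplies the constant. -/

/-! ### Areas of discs and of unions of two discs. -/

theorem measureReal_ball_plane (x : Plane) (r : ℝ) :
    volume.real (Metric.ball x r) = max r 0 ^ 2 * Real.pi := by
  rw [measureReal_def, EuclideanSpace.volume_ball_fin_two, ENNReal.toReal_mul, ENNReal.toReal_pow,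
    ENNReal.toReal_ofReal', ENNReal.toReal_ofReal Real.pi_pos.le]

theorem measureReal_closedBall_plane (x : Plane) (r : ℝ) :
    volume.real (Metric.closedBall x r) = max r 0 ^ 2 * Real.pi := by
  rw [measureReal_def, EuclideanSpace.volume_closedBall_fin_two, ENNReal.toReal_mul,
    ENNReal.toReal_pow, ENNReal.toReal_ofReal', ENNReal.toReal_ofReal Real.pi_pos.le]

/-- A point gained when passing from `S ∪ S'` to `T ∪ T'` lies in `T \ S` or in `T' \ S'`. This
reduces all continuity claims for unions of discs to the area formula of one disc. -/
theorem measureReal_union_le_add_sub {S T S' T' : Set Plane} (hS : MeasurableSet S)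
    (hS' : MeasurableSet S') (h : S ⊆ T) (h' : S' ⊆ T') (hT : volume T ≠ ⊤)
    (hT' : volume T' ≠ ⊤) :
    volume.real (T ∪ T') ≤ volume.real (S ∪ S') + (volume.real T - volume.real S) +
      (volume.real T' - volume.real S') := by
  have hsub : T ∪ T' ⊆ ((S ∪ S') ∪ (T \ S)) ∪ (T' \ S') := by
    intro z hz
    simp only [mem_union, Set.mem_sdiff] at hz ⊢
    tauto
  have hfin : volume (((S ∪ S') ∪ (T \ S)) ∪ (T' \ S')) ≠ ⊤ := by
    refine ne_top_of_le_ne_top (b := volume (T ∪ T')) (measure_union_ne_top hT hT')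
      (measure_mono ?_)
    intro z hz
    have := @h z
    have := @h' z
    simp only [mem_union, Set.mem_sdiff] at hz ⊢
    tauto
  have h1 := measureReal_mono hsub hfin
  have h2 := measureReal_union_le (μ := volume) ((S ∪ S') ∪ (T \ S)) (T' \ S')
  have h3 := measureReal_union_le (μ := volume) (S ∪ S') (T \ S)
  have h4 := measureReal_sdiff (μ := volume) h hS hT
  have h5 := measureReal_sdiff (μ := volume) h' hS' hT'
  linarith

/-- The union of the discs about `0` and `x` with `xs` on their boundary circles, the radii being
changed by `t`. -/
def discPair (xs x : Plane) (t : ℝ) : Set Plane :=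
  Metric.ball 0 (‖xs‖ + t) ∪ Metric.ball x (dist x xs + t)

/-- The closed version of `discPair`. -/
def closedDiscPair (xs x : Plane) (t : ℝ) : Set Plane :=
  Metric.closedBall 0 (‖xs‖ + t) ∪ Metric.closedBall x (dist x xs + t)

theorem measurableSet_discPair (xs x : Plane) (t : ℝ) : MeasurableSet (discPair xs x t) :=
  measurableSet_ball.union measurableSet_ball

theorem measurableSet_closedDiscPair (xs x : Plane) (t : ℝ) :
    MeasurableSet (closedDiscPair xs x t) :=
  Metric.isClosed_closedBall.measurableSet.union Metric.isClosed_closedBall.measurableSet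

theorem isBounded_discPair (xs x : Plane) (t : ℝ) : Bornology.IsBounded (discPair xs x t) :=
  Metric.isBounded_ball.union Metric.isBounded_ball

theorem isBounded_closedDiscPair (xs x : Plane) (t : ℝ) :
    Bornology.IsBounded (closedDiscPair xs x t) :=
  Metric.isBounded_closedBall.union Metric.isBounded_closedBall

theorem tendsto_measureReal_discPair (xs x : Plane) :
    Tendsto (fun ε => volume.real (discPair xs x (-ε))) (𝓝[>] 0)
      (𝓝 (volume.real (discPair xs x 0))) := by
  have hc : Continuous fun ε : ℝ => volume.real (discPair xs x 0) -
      (max (‖xs‖ + 0) 0 ^ 2 * Real.pi - max (‖xs‖ + -ε) 0 ^ 2 * Real.pi) -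
      (max (dist x xs + 0) 0 ^ 2 * Real.pi - max (dist x xs + -ε) 0 ^ 2 * Real.pi) := by
    fun_prop
  have hl := (hc.tendsto 0).mono_left (nhdsWithin_le_nhds (s := Ioi 0))
  simp only [neg_zero, sub_self, sub_zero] at hl
  refine tendsto_of_tendsto_of_tendsto_of_le_of_le' hl tendsto_const_nhds ?_ ?_
  · filter_upwards [self_mem_nhdsWithin] with ε (hε : 0 < ε)
    have := measureReal_union_le_add_sub
      (S := Metric.ball (0 : Plane) (‖xs‖ + -ε)) (T := Metric.ball (0 : Plane) (‖xs‖ + 0))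
      (S' := Metric.ball x (dist x xs + -ε)) (T' := Metric.ball x (dist x xs + 0))
      measurableSet_ball measurableSet_ball (Metric.ball_subset_ball (by linarith))
      (Metric.ball_subset_ball (by linarith)) measure_ball_lt_top.ne measure_ball_lt_top.ne
    simp only [measureReal_ball_plane] at this
    simp only [discPair]
    linarith
  · filter_upwards [self_mem_nhdsWithin] with ε (hε : 0 < ε)
    refine measureReal_mono ?_ (isBounded_discPair _ _ _).measure_lt_top.ne
    exact union_subset_union (Metric.ball_subset_ball (by linarith))
      (Metric.ball_subset_ball (by linarith))

theorem tendsto_measureReal_closedDiscPair (xs x : Plane) :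
    Tendsto (fun ε => volume.real (closedDiscPair xs x ε)) (𝓝[>] 0)
      (𝓝 (volume.real (discPair xs x 0))) := by
  have hc : Continuous fun ε : ℝ => volume.real (discPair xs x 0) +
      (max (‖xs‖ + ε) 0 ^ 2 * Real.pi - max (‖xs‖ + 0) 0 ^ 2 * Real.pi) +
      (max (dist x xs + ε) 0 ^ 2 * Real.pi - max (dist x xs + 0) 0 ^ 2 * Real.pi) := by
    fun_prop
  have hl := (hc.tendsto 0).mono_left (nhdsWithin_le_nhds (s := Ioi 0))
  simp only [sub_self, add_zero] at hl
  refine tendsto_of_tendsto_of_tendsto_of_le_of_le' tendsto_const_nhds hl ?_ ?_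
  · filter_upwards [self_mem_nhdsWithin] with ε (hε : 0 < ε)
    refine measureReal_mono ?_ (isBounded_closedDiscPair _ _ _).measure_lt_top.ne
    exact union_subset_union
      (Metric.ball_subset_closedBall.trans (Metric.closedBall_subset_closedBall (by linarith)))
      (Metric.ball_subset_closedBall.trans (Metric.closedBall_subset_closedBall (by linarith)))
  · filter_upwards [self_mem_nhdsWithin] with ε (hε : 0 < ε)
    have := measureReal_union_le_add_sub
      (S := Metric.ball (0 : Plane) (‖xs‖ + 0)) (T := Metric.closedBall (0 : Plane) (‖xs‖ + ε))
      (S' := Metric.ball x (dist x xs + 0)) (T' := Metric.closedBall x (dist x xs + ε))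
      measurableSet_ball measurableSet_ball
      (Metric.ball_subset_closedBall.trans (Metric.closedBall_subset_closedBall (by linarith)))
      (Metric.ball_subset_closedBall.trans (Metric.closedBall_subset_closedBall (by linarith)))
      measure_closedBall_lt_top.ne measure_closedBall_lt_top.ne
    simp only [measureReal_ball_plane, measureReal_closedBall_plane, add_zero] at this
    simp only [closedDiscPair, discPair, add_zero]
    linarith

/-- Moving the centre from `x` to `y` also changes the radius by at most `dist x y`, so the new disc
lies in the old one enlarged by `2 * dist x y`. Exchanging `x` and `y` gives the lower bound. The
continuity makes the angular integrands integrable. -/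
theorem continuous_measureReal_discPair (xs : Plane) :
    Continuous fun x => volume.real (discPair xs x 0) := by
  have key : ∀ x y : Plane, volume.real (discPair xs y 0) ≤ volume.real (discPair xs x 0) +
      ((dist x xs + 2 * dist x y) ^ 2 * Real.pi - dist x xs ^ 2 * Real.pi) := by
    intro x y
    have h1 : volume.real (discPair xs y 0) ≤ volume.real
        (Metric.ball (0 : Plane) (‖xs‖ + 0) ∪ Metric.ball x (dist x xs + 2 * dist x y)) := by
      refine measureReal_mono (union_subset_union_right _ ?_)
        (Metric.isBounded_ball.union Metric.isBounded_ball).measure_lt_top.ne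
      refine Metric.ball_subset_ball' ?_
      have := dist_triangle y x xs
      rw [dist_comm y x] at *
      linarith
    have h2 := measureReal_union_le_add_sub
      (S := Metric.ball (0 : Plane) (‖xs‖ + 0)) (T := Metric.ball (0 : Plane) (‖xs‖ + 0))
      (S' := Metric.ball x (dist x xs + 0)) (T' := Metric.ball x (dist x xs + 2 * dist x y))
      measurableSet_ball measurableSet_ball subset_rfl
      (Metric.ball_subset_ball (by linarith [dist_nonneg (x := x) (y := y)]))
      measure_ball_lt_top.ne measure_ball_lt_top.ne
    simp only [measureReal_ball_plane, add_zero] at h2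
    have hnn : 0 ≤ dist x xs + 2 * dist x y := by positivity
    rw [max_eq_left dist_nonneg, max_eq_left hnn] at h2
    simp only [discPair, add_zero] at h1 ⊢
    linarith
  rw [continuous_iff_continuousAt]
  intro x
  have hu : Continuous fun y : Plane => volume.real (discPair xs x 0) +
      ((dist x xs + 2 * dist x y) ^ 2 * Real.pi - dist x xs ^ 2 * Real.pi) := by fun_prop
  have hl : Continuous fun y : Plane => volume.real (discPair xs x 0) -
      ((dist y xs + 2 * dist x y) ^ 2 * Real.pi - dist y xs ^ 2 * Real.pi) := by fun_prop
  have hu' := hu.tendsto x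
  have hl' := hl.tendsto x
  simp only [dist_self, mul_zero, add_zero, sub_self, sub_zero] at hu' hl'
  refine tendsto_of_tendsto_of_tendsto_of_le_of_le hl' hu' (fun y => ?_) (fun y => key x y)
  have := key y x
  rw [dist_comm y x] at this
  simp only
  linarith

/-! ### The conditional probability as a void probability. -/

section Poisson

variable {Ω : Type*} [MeasurableSpace Ω] {P : Measure Ω} {Φ : Ω → Set Plane} {lam : ℝ}

theorem IsHomogeneousPPP.measureReal_count_mem (hΦ : IsHomogeneousPPP P Φ lam) {B : Set Plane}
    (hB : MeasurableSet B) (hb : Bornology.IsBounded B) (s : Set ℕ) :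
    P.real {ω | (Φ ω ∩ B).ncard ∈ s} =
      (poissonMeasure (Real.toNNReal (lam * volume.real B))).real s := by
  rw [← hΦ.map_count B hB hb, measureReal_def, measureReal_def,
    Measure.map_apply (hΦ.measurable_count B hB hb) (MeasurableSet.of_discrete)]
  rfl

theorem IsHomogeneousPPP.measureReal_count_inter (hΦ : IsHomogeneousPPP P Φ lam) {B C : Set Plane}
    (hB : MeasurableSet B) (hb : Bornology.IsBounded B) (hC : MeasurableSet C)
    (hc : Bornology.IsBounded C) (h : Disjoint B C) (s t : Set ℕ) :
    P.real ({ω | (Φ ω ∩ B).ncard ∈ s} ∩ {ω | (Φ ω ∩ C).ncard ∈ t}) =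
      P.real {ω | (Φ ω ∩ B).ncard ∈ s} * P.real {ω | (Φ ω ∩ C).ncard ∈ t} := by
  have hi := hΦ.indep_count 2 ![B, C] (by simp [Fin.forall_fin_two, hB, hC])
    (by simp [Fin.forall_fin_two, hb, hc]) (by
      intro i j hij
      fin_cases i <;> fin_cases j <;> simp_all [disjoint_comm])
  have h01 := (hi.indepFun (i := 0) (j := 1) (by decide)).measure_inter_preimage_eq_mul s t
    MeasurableSet.of_discrete MeasurableSet.of_discrete
  have := congrArg ENNReal.toReal h01
  rw [ENNReal.toReal_mul] at this
  exact this

/-- With `m = lam * |ball xs ε|`, independence on disjoint regions bounds `P.real (F ε)` below by `m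
* exp (-m)` and above by `1 - exp (-m) ≤ m`, each times a void probability whose region tends in
area to `discPair xs x 0`. -/
theorem tendsto_prob_div_of_sandwich [IsProbabilityMeasure P] (hΦ : IsHomogeneousPPP P Φ lam)
    (hlam : 0 < lam) (xs x : Plane) (F : ℝ → Set Ω)
    (hsub : ∀ ε > 0, F ε ⊆ {ω | (Φ ω ∩ Metric.ball xs ε).ncard ∈ ({0}ᶜ : Set ℕ)} ∩
      {ω | (Φ ω ∩ discPair xs x (-ε)).ncard ∈ ({0} : Set ℕ)})
    (hsup : ∀ ε > 0, {ω | (Φ ω ∩ Metric.ball xs ε).ncard ∈ ({1} : Set ℕ)} ∩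
      {ω | (Φ ω ∩ (closedDiscPair xs x ε \ Metric.ball xs ε)).ncard ∈ ({0} : Set ℕ)} ⊆ F ε) :
    Tendsto (fun ε => P.real (F ε) / (lam * volume.real (Metric.ball xs ε))) (𝓝[>] 0)
      (𝓝 (Real.exp (-(lam * volume.real (discPair xs x 0))))) := by
  have hm : Tendsto (fun ε => lam * volume.real (Metric.ball xs ε)) (𝓝[>] 0) (𝓝 0) := by
    have : Continuous fun ε : ℝ => lam * (max ε 0 ^ 2 * Real.pi) := by fun_prop
    have := (this.tendsto 0).mono_left (nhdsWithin_le_nhds (s := Ioi 0))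
    simpa [measureReal_ball_plane] using this
  have hlow : Tendsto (fun ε => Real.exp (-(lam * volume.real (Metric.ball xs ε))) *
      Real.exp (-(lam * volume.real (closedDiscPair xs x ε)))) (𝓝[>] 0)
      (𝓝 (Real.exp (-(lam * volume.real (discPair xs x 0))))) := by
    have h1 := (Real.continuous_exp.tendsto _).comp hm.neg
    have h2 := (Real.continuous_exp.tendsto _).comp
      ((tendsto_measureReal_closedDiscPair xs x).const_mul lam).neg
    simpa using h1.mul h2
  have hup : Tendsto (fun ε => Real.exp (-(lam * volume.real (discPair xs x (-ε))))) (𝓝[>] 0)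
      (𝓝 (Real.exp (-(lam * volume.real (discPair xs x 0))))) :=
    (Real.continuous_exp.tendsto _).comp
      ((tendsto_measureReal_discPair xs x).const_mul lam).neg
  refine tendsto_of_tendsto_of_tendsto_of_le_of_le' hlow hup ?_ ?_
  · filter_upwards [self_mem_nhdsWithin] with ε (hε : 0 < ε)
    have hpos : 0 < lam * volume.real (Metric.ball xs ε) := by
      rw [measureReal_ball_plane, max_eq_left hε.le]; positivity
    have h := measureReal_mono (μ := P) (hsup ε hε)
    rw [hΦ.measureReal_count_inter measurableSet_ball Metric.isBounded_ball
      ((measurableSet_closedDiscPair xs x ε).diff measurableSet_ball)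
      ((isBounded_closedDiscPair xs x ε).subset sdiff_subset) disjoint_sdiff_right,
      hΦ.measureReal_count_mem measurableSet_ball Metric.isBounded_ball,
      hΦ.measureReal_count_mem ((measurableSet_closedDiscPair xs x ε).diff measurableSet_ball)
        ((isBounded_closedDiscPair xs x ε).subset sdiff_subset),
      poissonMeasure_real_singleton, poissonMeasure_real_singleton,
      Real.coe_toNNReal _ hpos.le, Real.coe_toNNReal _ (by positivity)] at h
    rw [le_div_iff₀ hpos]
    refine le_trans ?_ h
    have hle : volume.real (closedDiscPair xs x ε \ Metric.ball xs ε) ≤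
        volume.real (closedDiscPair xs x ε) :=
      measureReal_mono sdiff_subset (isBounded_closedDiscPair xs x ε).measure_lt_top.ne
    have hexp : Real.exp (-(lam * volume.real (closedDiscPair xs x ε))) ≤
        Real.exp (-(lam * volume.real (closedDiscPair xs x ε \ Metric.ball xs ε))) :=
      Real.exp_le_exp.2 (neg_le_neg (mul_le_mul_of_nonneg_left hle hlam.le))
    have := mul_le_mul_of_nonneg_left hexp (mul_nonneg
      (Real.exp_pos (-(lam * volume.real (Metric.ball xs ε)))).le hpos.le)
    simp only [pow_one, Nat.factorial, pow_zero] at *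
    norm_num
    linarith
  · filter_upwards [self_mem_nhdsWithin] with ε (hε : 0 < ε)
    have hpos : 0 < lam * volume.real (Metric.ball xs ε) := by
      rw [measureReal_ball_plane, max_eq_left hε.le]; positivity
    -- Both circles pass through `xs`, so shrinking their radii by `ε` just clears the disc of
    -- radius `ε` about `xs`.
    have hdisj : Disjoint (Metric.ball xs ε) (discPair xs x (-ε)) := by
      refine disjoint_union_right.2 ⟨Metric.ball_disjoint_ball ?_, Metric.ball_disjoint_ball ?_⟩
      · rw [dist_zero_right]; linarith
      · rw [dist_comm]; linarith
    have h := measureReal_mono (μ := P) (hsub ε hε)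
    rw [hΦ.measureReal_count_inter measurableSet_ball Metric.isBounded_ball
      (measurableSet_discPair xs x (-ε)) (isBounded_discPair xs x (-ε)) hdisj,
      hΦ.measureReal_count_mem measurableSet_ball Metric.isBounded_ball,
      hΦ.measureReal_count_mem (measurableSet_discPair xs x (-ε)) (isBounded_discPair xs x (-ε)),
      probReal_compl_eq_one_sub (MeasurableSet.of_discrete),
      poissonMeasure_real_singleton, poissonMeasure_real_singleton,
      Real.coe_toNNReal _ hpos.le, Real.coe_toNNReal _ (by positivity)] at h
    rw [div_le_iff₀ hpos]
    refine h.trans ?_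
    have h1 := Real.add_one_le_exp (-(lam * volume.real (Metric.ball xs ε)))
    have := mul_le_mul_of_nonneg_left (show
        1 - Real.exp (-(lam * volume.real (Metric.ball xs ε))) ≤
          lam * volume.real (Metric.ball xs ε) by linarith)
      (Real.exp_pos (-(lam * volume.real (discPair xs x (-ε))))).le
    simp only [Nat.factorial, pow_zero] at *
    norm_num
    linarith

theorem IsHomogeneousPPP.inter_eq_empty (hΦ : IsHomogeneousPPP P Φ lam) {B : Set Plane}
    (hb : Bornology.IsBounded B) {ω : Ω} (h : (Φ ω ∩ B).ncard = 0) : Φ ω ∩ B = ∅ :=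
  (ncard_eq_zero (hΦ.locallyFinite ω B hb)).1 h

/-- As `z` is within `ε` of `xs`, its distances to `0` and `x` differ from those of `xs` by less
than `ε`. The weak inequality in `hx` lets the case `x = 0` serve for the denominator. -/
theorem IsHomogeneousPPP.count_of_nearest (hΦ : IsHomogeneousPPP P Φ lam) {xs x z : Plane} {ε : ℝ}
    {ω : Ω} (hz : z ∈ Metric.ball xs ε) (hn : IsNearestToOrigin (Φ ω) z)
    (hx : ∀ w ∈ Φ ω, dist x z ≤ dist x w) :
    (Φ ω ∩ Metric.ball xs ε).ncard ∈ ({0}ᶜ : Set ℕ) ∧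
      (Φ ω ∩ discPair xs x (-ε)).ncard ∈ ({0} : Set ℕ) := by
  constructor
  · intro h
    have := hΦ.inter_eq_empty Metric.isBounded_ball h
    exact (this ▸ (⟨hn.1, hz⟩ : z ∈ Φ ω ∩ Metric.ball xs ε) : z ∈ (∅ : Set Plane))
  · have : Φ ω ∩ discPair xs x (-ε) = ∅ := by
      rw [eq_empty_iff_forall_notMem]
      rintro w ⟨hw, h | h⟩
      · have h1 := hn.2 w hw
        rw [Metric.mem_ball, dist_eq_norm] at hz
        rw [mem_ball_zero_iff] at h
        have := norm_sub_norm_le xs z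
        rw [norm_sub_rev] at this
        linarith
      · have h1 := hx w hw
        rw [Metric.mem_ball] at hz h
        have := dist_triangle x z xs
        rw [dist_comm w x] at h
        linarith
    simp [this]

theorem IsHomogeneousPPP.nearest_of_count (hΦ : IsHomogeneousPPP P Φ lam) {xs x : Plane} {ε : ℝ}
    {ω : Ω} (h1 : (Φ ω ∩ Metric.ball xs ε).ncard = 1)
    (h0 : (Φ ω ∩ (closedDiscPair xs x ε \ Metric.ball xs ε)).ncard = 0) :
    ∃ z ∈ Metric.ball xs ε, IsNearestToOrigin (Φ ω) z ∧ x ∈ voronoiCell (Φ ω) z := by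
  obtain ⟨z, hz⟩ := ncard_eq_one.1 h1
  have he := hΦ.inter_eq_empty ((isBounded_closedDiscPair xs x ε).subset sdiff_subset) h0
  have hzm : z ∈ Φ ω ∩ Metric.ball xs ε := hz ▸ mem_singleton z
  have hfar : ∀ w ∈ Φ ω, w ≠ z → ‖xs‖ + ε < ‖w‖ ∧ dist x xs + ε < dist x w := by
    intro w hw hne
    have hwb : w ∉ Metric.ball xs ε := fun hb => hne (by
      have : w ∈ Φ ω ∩ Metric.ball xs ε := ⟨hw, hb⟩
      rw [hz] at this
      exact this)
    have hwc : w ∉ closedDiscPair xs x ε := fun hc => by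
      have : w ∈ Φ ω ∩ (closedDiscPair xs x ε \ Metric.ball xs ε) := ⟨hw, hc, hwb⟩
      rw [he] at this
      exact this
    simpa [closedDiscPair, dist_comm w x] using hwc
  have hzb : dist z xs < ε := hzm.2
  refine ⟨z, hzm.2, ⟨hzm.1, fun w hw => ?_⟩, fun w hw => ?_⟩
  · rcases eq_or_ne w z with rfl | hne
    · exact le_rfl
    · have := (hfar w hw hne).1
      have h := norm_sub_norm_le z xs
      rw [dist_eq_norm] at hzb
      linarith
  · have := (hfar w hw.1 hw.2).2
    have h := dist_triangle x xs z
    rw [dist_comm xs z] at h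
    linarith

theorem IsHomogeneousPPP.tendsto_cellProbNear [IsProbabilityMeasure P]
    (hΦ : IsHomogeneousPPP P Φ lam) (hlam : 0 < lam) (xs x : Plane) :
    Tendsto (cellProbNear P Φ xs x) (𝓝[>] 0) (𝓝 (Real.exp (-(lam *
      (volume.real (discPair xs x 0) - volume.real (Metric.ball (0 : Plane) ‖xs‖)))))) := by
  have hE := tendsto_prob_div_of_sandwich hΦ hlam xs x
    (fun ε => {ω | ∃ z ∈ Metric.ball xs ε, IsNearestToOrigin (Φ ω) z ∧ x ∈ voronoiCell (Φ ω) z})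
    (fun ε _ ω ⟨z, hz, hn, hv⟩ => hΦ.count_of_nearest hz hn fun w hw => by
      rcases eq_or_ne w z with rfl | hne
      · exact le_rfl
      · exact (hv w ⟨hw, hne⟩).le)
    (fun ε _ ω ⟨h1, h0⟩ => hΦ.nearest_of_count h1 h0)
  -- The denominator is treated as the case `x = 0`, where the two discs coincide.
  have hA := tendsto_prob_div_of_sandwich hΦ hlam xs 0
    (fun ε => {ω | ∃ z ∈ Metric.ball xs ε, IsNearestToOrigin (Φ ω) z})
    (fun ε _ ω ⟨z, hz, hn⟩ => hΦ.count_of_nearest hz hn fun w hw => by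
      simpa using hn.2 w hw)
    (fun ε _ ω ⟨h1, h0⟩ => by
      obtain ⟨z, hz, hn, -⟩ := hΦ.nearest_of_count h1 h0
      exact ⟨z, hz, hn⟩)
  have h0 : discPair xs 0 0 = Metric.ball (0 : Plane) ‖xs‖ := by simp [discPair]
  rw [h0] at hA
  have h := hE.div hA (Real.exp_pos _).ne'
  rw [← Real.exp_sub] at h
  refine Tendsto.congr' ?_ (h.trans_eq ?_)
  · filter_upwards [self_mem_nhdsWithin] with ε (hε : 0 < ε)
    have hpos : 0 < lam * volume.real (Metric.ball xs ε) := by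
      rw [measureReal_ball_plane, max_eq_left hε.le]; positivity
    simp only [Pi.div_apply, cellProbNear]
    exact div_div_div_cancel_right₀ hpos.ne' _ _
  · congr 2; ring

theorem IsHomogeneousPPP.cellProb_eq [IsProbabilityMeasure P]
    (hΦ : IsHomogeneousPPP P Φ lam) (hlam : 0 < lam) (xs x : Plane) :
    cellProb P Φ xs x = Real.exp (-(lam *
      (volume.real (discPair xs x 0) - volume.real (Metric.ball (0 : Plane) ‖xs‖)))) :=
  (hΦ.tendsto_cellProbNear hlam xs x).limUnder_eq

end Poisson

/-! ### The area of the lune. -/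

theorem measureReal_discPair_sub (xs x : Plane) :
    volume.real (discPair xs x 0) - volume.real (Metric.ball (0 : Plane) ‖xs‖) =
      volume.real (Metric.ball x (dist x xs) \ Metric.closedBall 0 ‖xs‖) := by
  have hfin : volume (Metric.ball x (dist x xs) \ Metric.closedBall (0 : Plane) ‖xs‖) ≠ ⊤ :=
    (Metric.isBounded_ball.subset sdiff_subset).measure_lt_top.ne
  have hdisj : Disjoint (Metric.closedBall (0 : Plane) ‖xs‖)
      (Metric.ball x (dist x xs) \ Metric.closedBall 0 ‖xs‖) := disjoint_sdiff_right
  have h1 := measureReal_union (μ := volume) hdisj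
    (measurableSet_ball.diff Metric.isClosed_closedBall.measurableSet)
    measure_closedBall_lt_top.ne hfin
  have h2 := measureReal_union (μ := volume) (hdisj.mono_left Metric.ball_subset_closedBall)
    (measurableSet_ball.diff Metric.isClosed_closedBall.measurableSet)
    measure_ball_lt_top.ne hfin
  have heq : volume.real (Metric.closedBall (0 : Plane) ‖xs‖) =
      volume.real (Metric.ball (0 : Plane) ‖xs‖) := by
    rw [measureReal_closedBall_plane, measureReal_ball_plane]
  have hle : volume.real (discPair xs x 0) ≤ volume.real (Metric.closedBall (0 : Plane) ‖xs‖ ∪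
      Metric.ball x (dist x xs) \ Metric.closedBall 0 ‖xs‖) := by
    refine measureReal_mono ?_
      (Metric.isBounded_closedBall.union (Metric.isBounded_ball.subset sdiff_subset)
        ).measure_lt_top.ne
    rw [union_sdiff_self, discPair, add_zero, add_zero]
    exact union_subset_union_left _ Metric.ball_subset_closedBall
  have hge : volume.real (Metric.ball (0 : Plane) ‖xs‖ ∪
      Metric.ball x (dist x xs) \ Metric.closedBall 0 ‖xs‖) ≤ volume.real (discPair xs x 0) := by
    refine measureReal_mono ?_ (isBounded_discPair _ _ _).measure_lt_top.ne
    rw [discPair, add_zero, add_zero]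
    exact union_subset_union_right _ sdiff_subset
  linarith

/-- Difference times sum of the two roots is always `R ^ 2 - d ^ 2`, and the sum is larger at `b`
than at `h`. -/
theorem sqrt_sub_sqrt_le {R d b h : ℝ} (hdR : d ^ 2 < R ^ 2) (hb : b ^ 2 ≤ h ^ 2)
    (hh : h ^ 2 ≤ d ^ 2) :
    √(R ^ 2 - b ^ 2) - √(d ^ 2 - b ^ 2) ≤ √(R ^ 2 - h ^ 2) - √(d ^ 2 - h ^ 2) := by
  have hp : √(R ^ 2 - h ^ 2) ≤ √(R ^ 2 - b ^ 2) := Real.sqrt_le_sqrt (by linarith)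
  have hq : √(d ^ 2 - h ^ 2) ≤ √(d ^ 2 - b ^ 2) := Real.sqrt_le_sqrt (by linarith)
  have hP : √(d ^ 2 - h ^ 2) < √(R ^ 2 - h ^ 2) :=
    Real.sqrt_lt_sqrt (by linarith) (by linarith)
  have h1 := Real.sq_sqrt (show 0 ≤ R ^ 2 - h ^ 2 by linarith)
  have h2 := Real.sq_sqrt (show 0 ≤ R ^ 2 - b ^ 2 by linarith)
  have h3 := Real.sq_sqrt (show 0 ≤ d ^ 2 - h ^ 2 by linarith)
  have h4 := Real.sq_sqrt (show 0 ≤ d ^ 2 - b ^ 2 by linarith)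
  have h5 := Real.sqrt_nonneg (d ^ 2 - h ^ 2)
  generalize √(R ^ 2 - h ^ 2) = P at *
  generalize √(d ^ 2 - h ^ 2) = Q at *
  generalize √(R ^ 2 - b ^ 2) = p at *
  generalize √(d ^ 2 - b ^ 2) = q at *
  have e : (p - q) * (p + q) = (P - Q) * (P + Q) := by linarith
  by_contra! hlt
  have : (P - Q) * (P + Q) < (p - q) * (P + Q) := mul_lt_mul_of_pos_right hlt (by linarith)
  have : (p - q) * (P + Q) ≤ (p - q) * (p + q) :=
    mul_le_mul_of_nonneg_left (by linarith) (by linarith)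
  linarith

/-- Here `a` is the coordinate along the line of centres and `b` the transverse one. The hypothesis
`heq` says that the circles meet at `b = ±h`, on the far side of both centres. -/
theorem mem_lune_iff {ρ d R h a b : ℝ} (hρ : 0 < ρ) (hd : 0 < d) (hdR : d < R) (h0 : 0 ≤ h)
    (hhd : h ≤ d) (heq : √(R ^ 2 - h ^ 2) = ρ + √(d ^ 2 - h ^ 2)) :
    (b ^ 2 + (a - ρ) ^ 2 < d ^ 2 ∧ R ^ 2 < b ^ 2 + a ^ 2) ↔
      (b ∈ Ioo (-h) h ∧ a ∈ Ioo (√(R ^ 2 - b ^ 2)) (ρ + √(d ^ 2 - b ^ 2))) := by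
  have hdR2 : d ^ 2 < R ^ 2 := by nlinarith
  have hhd2 : h ^ 2 ≤ d ^ 2 := by nlinarith
  constructor
  · rintro ⟨h1, h2⟩
    have hb : b ^ 2 ≤ d ^ 2 := by nlinarith [sq_nonneg (a - ρ)]
    have ha := abs_lt.1 (Real.lt_sqrt_of_sq_lt (x := |a - ρ|) (y := d ^ 2 - b ^ 2)
      (by rw [sq_abs]; linarith))
    have hdr : √(d ^ 2 - b ^ 2) ≤ √(R ^ 2 - b ^ 2) := Real.sqrt_le_sqrt (by linarith)
    have hR : √(R ^ 2 - b ^ 2) < |a| := by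
      rw [← Real.sqrt_sq_eq_abs]
      exact Real.sqrt_lt_sqrt (by linarith) (by linarith)
    -- For negative `a`, `|a - ρ|` would exceed `|a|`, contradicting the bound by the smaller root.
    have ha0 : √(R ^ 2 - b ^ 2) < a := by
      rcases abs_cases a with ⟨e, -⟩ | ⟨e, -⟩
      · linarith
      · linarith
    have hbh : b ^ 2 < h ^ 2 := by
      by_contra! hle
      have := sqrt_sub_sqrt_le hdR2 hle hb
      linarith
    exact ⟨abs_lt.1 (abs_lt_of_sq_lt_sq hbh h0), ha0, by linarith⟩
  · rintro ⟨hb, ha1, ha2⟩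
    have hbh : b ^ 2 ≤ h ^ 2 := by nlinarith [hb.1, hb.2]
    have hs := Real.sqrt_nonneg (R ^ 2 - b ^ 2)
    have h1 : R ^ 2 - b ^ 2 < a ^ 2 := Real.lt_sq_of_sqrt_lt ha1
    have hp : √(R ^ 2 - h ^ 2) ≤ √(R ^ 2 - b ^ 2) := Real.sqrt_le_sqrt (by linarith)
    have hQ := Real.sqrt_nonneg (d ^ 2 - h ^ 2)
    have hq := Real.sqrt_nonneg (d ^ 2 - b ^ 2)
    have h2 : (a - ρ) ^ 2 < √(d ^ 2 - b ^ 2) ^ 2 :=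
      sq_lt_sq' (by linarith) (by linarith)
    rw [Real.sq_sqrt (by linarith)] at h2
    exact ⟨by linarith, by linarith⟩

/-- A reflection fixing `0` takes `x` to the second coordinate axis, where the lune is the region
between two graphs. -/
theorem measureReal_lune_eq_integral {ρ d R h : ℝ} (hρ : 0 < ρ) (hd : 0 < d) (hdR : d < R)
    (h0 : 0 ≤ h) (hhd : h ≤ d) (heq : √(R ^ 2 - h ^ 2) = ρ + √(d ^ 2 - h ^ 2))
    {x : Plane} (hx : ‖x‖ = ρ) :
    volume.real (Metric.ball x d \ Metric.closedBall 0 R) =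
      ∫ b in (-h)..h, (ρ + √(d ^ 2 - b ^ 2) - √(R ^ 2 - b ^ 2)) := by
  have hR : 0 < R := hd.trans hdR
  set y : Plane := !₂[0, ρ] with hy
  have hyn : ‖x‖ = ‖y‖ := by
    rw [hx, EuclideanSpace.norm_eq]
    simp [hy, Real.sqrt_sq hρ.le]
  set f : Plane ≃ₗᵢ[ℝ] Plane := (ℝ ∙ (x - y))ᗮ.reflection with hf
  have hfx : f x = y := Submodule.reflection_sub hyn
  have hpre : f ⁻¹' (Metric.ball y d \ Metric.closedBall 0 R) =
      Metric.ball x d \ Metric.closedBall 0 R := by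
    ext z
    simp only [mem_preimage, Set.mem_sdiff, Metric.mem_ball, mem_closedBall_zero_iff, ← hfx,
      f.norm_map, f.dist_map]
  have hT : MeasurePreserving (fun v : Plane => ((v 0, v 1) : ℝ × ℝ)) :=
    (volume_preserving_finTwoArrow ℝ).comp (PiLp.volume_preserving_ofLp (Fin 2))
  have hreg : (fun v : Plane => ((v 0, v 1) : ℝ × ℝ)) ⁻¹'
      regionBetween (fun b => √(R ^ 2 - b ^ 2)) (fun b => ρ + √(d ^ 2 - b ^ 2)) (Ioo (-h) h) =
      Metric.ball y d \ Metric.closedBall 0 R := by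
    ext v
    rw [mem_preimage, regionBetween, mem_ofPred_eq, ← mem_lune_iff hρ hd hdR h0 hhd heq,
      Set.mem_sdiff, Metric.mem_ball, mem_closedBall_zero_iff, EuclideanSpace.dist_eq,
      EuclideanSpace.norm_eq, Real.sqrt_lt' hd, Real.sqrt_le_left hR.le]
    simp [hy, Real.dist_eq, Fin.sum_univ_two]
  have hmeas : MeasurableSet (Metric.ball y d \ Metric.closedBall (0 : Plane) R) :=
    measurableSet_ball.diff Metric.isClosed_closedBall.measurableSet
  have hc1 : Continuous fun b : ℝ => √(R ^ 2 - b ^ 2) := by fun_prop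
  have hc2 : Continuous fun b : ℝ => ρ + √(d ^ 2 - b ^ 2) := by fun_prop
  have hle : ∀ b ∈ Ioo (-h) h, √(R ^ 2 - b ^ 2) ≤ ρ + √(d ^ 2 - b ^ 2) := by
    intro b hb
    have := sqrt_sub_sqrt_le (R := R) (d := d) (b := b) (h := h) (by nlinarith)
      (by nlinarith [hb.1, hb.2]) (by nlinarith)
    linarith
  rw [← hpre, (f.measurePreserving).measureReal_preimage hmeas.nullMeasurableSet, ← hreg,
    hT.measureReal_preimage
      (measurableSet_regionBetween hc1.measurable hc2.measurable
        measurableSet_Ioo).nullMeasurableSet,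
    measureReal_def, Measure.volume_eq_prod,
    volume_regionBetween_eq_integral
      (hc1.integrableOn_Icc.mono_set Ioo_subset_Icc_self)
      (hc2.integrableOn_Icc.mono_set Ioo_subset_Icc_self) measurableSet_Ioo hle,
    ENNReal.toReal_ofReal (setIntegral_nonneg measurableSet_Ioo fun b hb => by
      simpa using hle b hb),
    intervalIntegral.integral_of_le (by linarith), integral_Ioc_eq_integral_Ioo]
  rfl

theorem abs_sqrt_sub_le {R b : ℝ} (hR : 0 < R) (hb : b ^ 2 ≤ R ^ 2) :
    |√(R ^ 2 - b ^ 2) - (R - b ^ 2 / (2 * R))| ≤ b ^ 4 / (2 * R ^ 3) := by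
  obtain ⟨t, rfl⟩ : ∃ t, b = R * t := ⟨b / R, by field_simp⟩
  have ht : t ^ 2 ≤ 1 := by
    rw [mul_pow] at hb
    have : 0 < R ^ 2 := by positivity
    nlinarith
  have h1 : √(R ^ 2 - (R * t) ^ 2) = R * √(1 - t ^ 2) := by
    rw [show R ^ 2 - (R * t) ^ 2 = R ^ 2 * (1 - t ^ 2) by ring,
      Real.sqrt_mul (by positivity), Real.sqrt_sq hR.le]
  have h2 : R - (R * t) ^ 2 / (2 * R) = R * (1 - t ^ 2 / 2) := by field_simp
  have h3 : (R * t) ^ 4 / (2 * R ^ 3) = R * (t ^ 4 / 2) := by field_simp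
  rw [h1, h2, h3, ← mul_sub, abs_mul, abs_of_pos hR]
  refine mul_le_mul_of_nonneg_left ?_ hR.le
  have hu : √(1 - t ^ 2) ≤ 1 - t ^ 2 / 2 :=
    Real.sqrt_le_iff.2 ⟨by linarith, by nlinarith [sq_nonneg (t ^ 2)]⟩
  have hl : 1 - t ^ 2 / 2 - t ^ 4 / 2 ≤ √(1 - t ^ 2) := by
    refine Real.le_sqrt_of_sq_le ?_
    have h4 : t ^ 4 = (t ^ 2) ^ 2 := by ring
    have h0 := sq_nonneg t
    rw [h4]
    generalize t ^ 2 = s at *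
    nlinarith [mul_nonneg (mul_nonneg h0 h0) (sub_nonneg.2 ht),
      mul_nonneg (mul_nonneg h0 h0) (mul_nonneg h0 (sub_nonneg.2 ht))]
  rw [abs_le]
  constructor <;> nlinarith [sq_nonneg (t ^ 2)]

/-- By `heq` the integrand vanishes at `b = ±h`. Expanding all four roots to second order leaves a
parabola with the same zeros and an error of order `h ^ 4` on an interval of length `2 * h`. -/
theorem abs_integral_lune_sub_le {ρ d R h : ℝ} (hd : 0 < d) (hdR : d < R)
    (h0 : 0 ≤ h) (hhd : h ≤ d) (heq : √(R ^ 2 - h ^ 2) = ρ + √(d ^ 2 - h ^ 2)) :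
    |(∫ b in (-h)..h, (ρ + √(d ^ 2 - b ^ 2) - √(R ^ 2 - b ^ 2))) -
      2 / 3 * (1 / d - 1 / R) * h ^ 3| ≤ 2 * h ^ 5 * (1 / R ^ 3 + 1 / d ^ 3) := by
  have hR : 0 < R := hd.trans hdR
  have hint : ∫ b in (-h)..h, (1 / d - 1 / R) / 2 * (h ^ 2 - b ^ 2) =
      2 / 3 * (1 / d - 1 / R) * h ^ 3 := by
    rw [intervalIntegral.integral_const_mul, intervalIntegral.integral_sub (by simp)
      (by apply Continuous.intervalIntegrable; fun_prop), integral_pow,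
      intervalIntegral.integral_const]
    simp only [smul_eq_mul]
    push_cast
    ring
  rw [← hint, ← intervalIntegral.integral_sub
    (by apply Continuous.intervalIntegrable; fun_prop)
    (by apply Continuous.intervalIntegrable; fun_prop)]
  have hbound : ∀ b ∈ uIoc (-h) h, ‖(ρ + √(d ^ 2 - b ^ 2) - √(R ^ 2 - b ^ 2)) -
      (1 / d - 1 / R) / 2 * (h ^ 2 - b ^ 2)‖ ≤ h ^ 4 * (1 / R ^ 3 + 1 / d ^ 3) := by
    intro b hb
    rw [uIoc_of_le (by linarith)] at hb
    have hb2 : b ^ 2 ≤ h ^ 2 := by nlinarith [hb.1, hb.2]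
    have hh2 : h ^ 2 ≤ d ^ 2 := by nlinarith
    have hd2 : d ^ 2 ≤ R ^ 2 := by nlinarith
    have hb4 : b ^ 4 ≤ h ^ 4 := by nlinarith [sq_nonneg b, sq_nonneg h]
    have a1 := abs_le.1 (abs_sqrt_sub_le hd (hb2.trans hh2))
    have a2 := abs_le.1 (abs_sqrt_sub_le hR ((hb2.trans hh2).trans hd2))
    have a3 := abs_le.1 (abs_sqrt_sub_le hd hh2)
    have a4 := abs_le.1 (abs_sqrt_sub_le hR (hh2.trans hd2))
    have c1 : b ^ 4 / (2 * d ^ 3) ≤ h ^ 4 / (2 * d ^ 3) := by gcongr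
    have c2 : b ^ 4 / (2 * R ^ 3) ≤ h ^ 4 / (2 * R ^ 3) := by gcongr
    have e1 : (1 / d - 1 / R) / 2 * (h ^ 2 - b ^ 2) =
        (h ^ 2 / (2 * d) - b ^ 2 / (2 * d)) - (h ^ 2 / (2 * R) - b ^ 2 / (2 * R)) := by
      field_simp
    have e2 : h ^ 4 * (1 / R ^ 3 + 1 / d ^ 3) =
        2 * (h ^ 4 / (2 * R ^ 3)) + 2 * (h ^ 4 / (2 * d ^ 3)) := by
      field_simp
    rw [e1, e2, Real.norm_eq_abs, abs_le]
    constructor <;> linarith [a1.1, a1.2, a2.1, a2.2, a3.1, a3.2, a4.1, a4.2]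
  have := intervalIntegral.norm_integral_le_of_norm_le_const hbound
  rw [Real.norm_eq_abs, abs_of_nonneg (show 0 ≤ h - -h by linarith)] at this
  refine this.trans (le_of_eq (by ring))

theorem plane_norm_sq (x : Plane) : ‖x‖ ^ 2 = x 0 ^ 2 + x 1 ^ 2 := by
  rw [EuclideanSpace.real_norm_sq_eq, Fin.sum_univ_two]

/-- The area added to the disc about `0` through `xs` by the disc about `x` through `xs`, up to
fifth order in the distance of `xs` from the line through `0` and `x`. -/
theorem abs_measureReal_discPair_sub_le {xs x : Plane} (hx : x ≠ 0) (hd : 0 < dist x xs)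
    (hdR : dist x xs < ‖xs‖) (hin : ‖x‖ ^ 2 ≤ xs 0 * x 0 + xs 1 * x 1) :
    |volume.real (discPair xs x 0) - volume.real (Metric.ball (0 : Plane) ‖xs‖) -
      2 / 3 * (1 / dist x xs - 1 / ‖xs‖) * (|xs 0 * x 1 - xs 1 * x 0| / ‖x‖) ^ 3| ≤
      2 * (|xs 0 * x 1 - xs 1 * x 0| / ‖x‖) ^ 5 * (1 / ‖xs‖ ^ 3 + 1 / dist x xs ^ 3) := by
  have hρ : 0 < ‖x‖ := norm_pos_iff.2 hx
  have hxx := plane_norm_sq x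
  have hss := plane_norm_sq xs
  have hdd : dist x xs ^ 2 = (x 0 - xs 0) ^ 2 + (x 1 - xs 1) ^ 2 := by
    rw [dist_eq_norm, plane_norm_sq]; simp
  set h := |xs 0 * x 1 - xs 1 * x 0| / ‖x‖ with hh
  set I := xs 0 * x 0 + xs 1 * x 1 with hI
  have h0 : 0 ≤ h := by positivity
  have hh2 : h ^ 2 * ‖x‖ ^ 2 = (xs 0 * x 1 - xs 1 * x 0) ^ 2 := by
    rw [hh, div_pow, sq_abs]; field_simp
  -- `I / ‖x‖` is the signed length of the projection of `xs` onto the direction of `x`, and `h` is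
  -- the distance of `xs` from that line.
  have e1 : ‖xs‖ ^ 2 - h ^ 2 = (I / ‖x‖) ^ 2 := by
    rw [div_pow I, eq_div_iff (by positivity), sub_mul, hh2, hss, hxx, hI]; ring
  have e2 : dist x xs ^ 2 - h ^ 2 = (I / ‖x‖ - ‖x‖) ^ 2 := by
    have : dist x xs ^ 2 = ‖xs‖ ^ 2 - 2 * I + ‖x‖ ^ 2 := by rw [hdd, hss, hxx, hI]; ring
    rw [this, show ‖xs‖ ^ 2 - 2 * I + ‖x‖ ^ 2 - h ^ 2 = (‖xs‖ ^ 2 - h ^ 2) - 2 * I + ‖x‖ ^ 2 by ring,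
      e1]
    field_simp
    ring
  -- The projection of `xs` falls at or beyond `x`, which fixes the sign of the second root.
  have hI0 : ‖x‖ ≤ I / ‖x‖ := by rw [le_div_iff₀ hρ]; linarith
  have heq : √(‖xs‖ ^ 2 - h ^ 2) = ‖x‖ + √(dist x xs ^ 2 - h ^ 2) := by
    rw [e1, e2, Real.sqrt_sq (by linarith), Real.sqrt_sq (by linarith)]; ring
  have hhd : h ≤ dist x xs := by
    refine (sq_le_sq₀ h0 hd.le).1 ?_
    have := sq_nonneg (I / ‖x‖ - ‖x‖)
    linarith
  rw [measureReal_discPair_sub, measureReal_lune_eq_integral hρ hd hdR h0 hhd heq rfl]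
  exact abs_integral_lune_sub_le hd hdR h0 hhd heq

/-! ### Expansion of the added area and of the exponential near `xR`. -/

/-- The area which the disc about `x` through `xs` adds to the disc about `0` through `xs`. -/
noncomputable def addedArea (xs x : Plane) : ℝ :=
  volume.real (discPair xs x 0) - volume.real (Metric.ball (0 : Plane) ‖xs‖)

theorem continuous_addedArea (xs : Plane) : Continuous (addedArea xs) :=
  (continuous_measureReal_discPair xs).sub continuous_const

/-- The cross product of two vectors of the plane. -/
def planeCross (x y : Plane) : ℝ := x 0 * y 1 - x 1 * y 0

theorem planeCross_isBigO (xs : Plane) :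
    (fun e => |planeCross xs e|) =O[𝓝 0] fun e : Plane => ‖e‖ := by
  have hdiff : DifferentiableAt ℝ (fun e => planeCross xs e) 0 := by
    unfold planeCross; fun_prop
  have := hdiff.isBigO_sub
  simp only [planeCross, PiLp.zero_apply, mul_zero, sub_zero] at this
  exact this.norm_left.norm_right

/-- The half-chord is `|planeCross xs e| / ‖e + xR‖`, of first order in `e`. The lune error is then
`O(‖e‖^5)`, and freezing the differentiable coefficient at `e = 0` costs one order on top of the
cube. -/
theorem addedArea_isBigO {xs xR : Plane} {t : ℝ} (hxs : xs ≠ 0) (ht0 : 0 < t) (ht1 : t < 1)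
    (hxR : xR = t • xs) :
    (fun e => addedArea xs (e + xR) - 2 / 3 * (1 / (‖xs‖ - ‖xR‖) - 1 / ‖xs‖) / ‖xR‖ ^ 3 *
      |planeCross xs e| ^ 3) =O[𝓝 0] fun e : Plane => ‖e‖ ^ 4 := by
  have hR : 0 < ‖xs‖ := norm_pos_iff.2 hxs
  have hs : ‖xR‖ = t * ‖xs‖ := by rw [hxR, norm_smul, Real.norm_eq_abs, abs_of_pos ht0]
  have hs0 : 0 < ‖xR‖ := by rw [hs]; positivity
  have hxR0 : xR ≠ 0 := norm_pos_iff.1 hs0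
  have hsub : xR - xs = (t - 1) • xs := by rw [hxR, sub_smul, one_smul]
  have hd : ‖xR - xs‖ = ‖xs‖ - ‖xR‖ := by
    rw [hsub, norm_smul, Real.norm_eq_abs, abs_of_neg (by linarith), hs]; ring
  have hd0 : 0 < ‖xR - xs‖ := by rw [hd, hs]; nlinarith
  have hdne : xR - xs ≠ 0 := norm_pos_iff.1 hd0
  have hc := planeCross_isBigO xs
  -- The contribution of `xR` vanishes because it is parallel to `xs`.
  have hcoord : ∀ e : Plane, xs 0 * (e + xR) 1 - xs 1 * (e + xR) 0 = planeCross xs e := by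
    intro e
    simp only [planeCross, hxR, PiLp.add_apply, PiLp.smul_apply, smul_eq_mul]
    ring
  -- the estimate of the lune with the distances at `e + xR`
  have h1 : (fun e => addedArea xs (e + xR) -
      2 / 3 * (1 / ‖e + xR - xs‖ - 1 / ‖xs‖) / ‖e + xR‖ ^ 3 * |planeCross xs e| ^ 3)
      =O[𝓝 0] fun e : Plane => ‖e‖ ^ 4 := by
    have hev : ∀ᶠ e : Plane in 𝓝 0, e + xR ≠ 0 ∧ 0 < ‖e + xR - xs‖ ∧ ‖e + xR - xs‖ < ‖xs‖ ∧
        ‖e + xR‖ ^ 2 < xs 0 * (e + xR) 0 + xs 1 * (e + xR) 1 := by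
      refine Eventually.and ?_ (Eventually.and ?_ (Eventually.and ?_ ?_))
      · refine ContinuousAt.eventually_ne (by fun_prop) (by simpa using hxR0)
      · refine ContinuousAt.eventually_lt (by fun_prop) (by fun_prop) (by simpa using hdne)
      · refine ContinuousAt.eventually_lt (by fun_prop) (by fun_prop) ?_
        rw [zero_add, hd]; linarith
      · refine ContinuousAt.eventually_lt (by fun_prop) (by fun_prop) ?_
        have := plane_norm_sq xs
        rw [zero_add, hs, hxR]
        simp only [PiLp.smul_apply, smul_eq_mul]
        have h2 : xs 0 * (t * xs 0) + xs 1 * (t * xs 1) = t * ‖xs‖ ^ 2 := by rw [this]; ring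
        rw [h2, mul_pow]
        have : t ^ 2 < t := by nlinarith
        exact mul_lt_mul_of_pos_right this (by positivity)
    have hB : (fun e : Plane => 2 / ‖e + xR‖ ^ 5 * (1 / ‖xs‖ ^ 3 + 1 / ‖e + xR - xs‖ ^ 3))
        =O[𝓝 0] fun _ => (1 : ℝ) := by
      refine (ContinuousAt.tendsto ?_).isBigO_one ℝ
      have a1 : ‖(0 : Plane) + xR‖ ^ 5 ≠ 0 := by rw [zero_add]; positivity
      have a2 : ‖(0 : Plane) + xR - xs‖ ^ 3 ≠ 0 := by rw [zero_add]; positivity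
      fun_prop (disch := assumption)
    have hle : (fun e => addedArea xs (e + xR) -
        2 / 3 * (1 / ‖e + xR - xs‖ - 1 / ‖xs‖) / ‖e + xR‖ ^ 3 * |planeCross xs e| ^ 3)
        =O[𝓝 0] fun e : Plane => 2 / ‖e + xR‖ ^ 5 *
          (1 / ‖xs‖ ^ 3 + 1 / ‖e + xR - xs‖ ^ 3) * |planeCross xs e| ^ 5 := by
      refine IsBigO.of_bound 1 ?_
      filter_upwards [hev] with e ⟨he0, he1, he2, he3⟩
      have key := abs_measureReal_discPair_sub_le (xs := xs) he0 (by rwa [dist_eq_norm])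
        (by rwa [dist_eq_norm]) he3.le
      rw [hcoord, dist_eq_norm] at key
      rw [one_mul, Real.norm_eq_abs, Real.norm_eq_abs]
      refine le_trans (le_of_eq ?_) (key.trans (le_trans (le_of_eq ?_) (le_abs_self _)))
      · rw [addedArea, div_pow]; congr 1; ring
      · rw [div_pow]; ring
    refine hle.trans ((hB.mul (hc.pow 5)).trans ?_)
    have h54 : (fun e : Plane => ‖e‖ ^ 5) =O[𝓝 0] fun e : Plane => ‖e‖ ^ 4 := by
      have hone : (fun e : Plane => ‖e‖) =O[𝓝 0] fun _ => (1 : ℝ) :=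
        (Continuous.tendsto (by fun_prop) _).isBigO_one ℝ
      have := hone.mul (isBigO_refl (fun e : Plane => ‖e‖ ^ 4) (𝓝 0))
      simpa [← pow_succ'] using this
    simpa using h54
  -- replacing the distances by those at `xR`
  have h2 : (fun e => (2 / 3 * (1 / ‖e + xR - xs‖ - 1 / ‖xs‖) / ‖e + xR‖ ^ 3 -
      2 / 3 * (1 / (‖xs‖ - ‖xR‖) - 1 / ‖xs‖) / ‖xR‖ ^ 3) * |planeCross xs e| ^ 3)
      =O[𝓝 0] fun e : Plane => ‖e‖ ^ 4 := by
    have hdiff : DifferentiableAt ℝ (fun e : Plane =>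
        2 / 3 * (1 / ‖e + xR - xs‖ - 1 / ‖xs‖) / ‖e + xR‖ ^ 3) 0 := by
      have d1 : DifferentiableAt ℝ (fun e : Plane => ‖e + xR‖) 0 :=
        DifferentiableAt.norm ℝ (by fun_prop) (by simpa using hxR0)
      have d2 : DifferentiableAt ℝ (fun e : Plane => ‖e + xR - xs‖) 0 :=
        DifferentiableAt.norm ℝ (by fun_prop) (by simpa using hdne)
      have a1 : ‖(0 : Plane) + xR‖ ^ 3 ≠ 0 := by rw [zero_add]; positivity
      have a2 : ‖(0 : Plane) + xR - xs‖ ≠ 0 := by rw [zero_add]; positivity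
      simp only [div_eq_mul_inv, one_mul]
      exact (((d2.fun_inv a2).sub_const _).const_mul _).mul ((d1.pow 3).fun_inv a1)
    have h := hdiff.isBigO_sub
    simp only [zero_add, hd, sub_zero] at h
    refine (h.norm_right.mul (hc.pow 3)).congr_right fun e => ?_
    ring
  refine (h1.add h2).congr_left fun e => ?_
  ring

theorem one_sub_exp_isBigO {ι : Type*} {l : Filter ι} {u : ι → ℝ} (hu : Tendsto u l (𝓝 0)) :
    (fun i => 1 - Real.exp (-(u i)) - u i) =O[l] fun i => u i ^ 2 := by
  refine IsBigO.of_bound 1 ?_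
  have h1 : ∀ᶠ i in l, |u i| < 1 := by
    have := hu.abs
    rw [abs_zero] at this
    exact this.eventually_lt_const one_pos
  filter_upwards [h1] with i hi
  have := Real.abs_exp_sub_one_sub_id_le (x := -(u i)) (by rw [abs_neg]; exact hi.le)
  rw [neg_sq] at this
  rw [one_mul, Real.norm_eq_abs, Real.norm_eq_abs, abs_of_nonneg (sq_nonneg (u i)), ← abs_neg]
  convert this using 2
  ring

theorem one_sub_exp_addedArea_isBigO {xs xR : Plane} {t : ℝ} (lam : ℝ) (hxs : xs ≠ 0) (ht0 : 0 < t)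
    (ht1 : t < 1) (hxR : xR = t • xs) :
    (fun e => 1 - Real.exp (-(lam * addedArea xs (e + xR))) -
      lam * (2 / 3 * (1 / (‖xs‖ - ‖xR‖) - 1 / ‖xs‖) / ‖xR‖ ^ 3) * |planeCross xs e| ^ 3)
      =O[𝓝 0] fun e : Plane => ‖e‖ ^ 4 := by
  have hA := addedArea_isBigO hxs ht0 ht1 hxR
  have hpow : ∀ m n : ℕ, m ≤ n → (fun e : Plane => ‖e‖ ^ n) =O[𝓝 0] fun e : Plane => ‖e‖ ^ m := by
    intro m n hmn
    have hone : (fun e : Plane => ‖e‖ ^ (n - m)) =O[𝓝 0] fun _ => (1 : ℝ) :=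
      (Continuous.tendsto (by fun_prop) _).isBigO_one ℝ
    have := hone.mul (isBigO_refl (fun e : Plane => ‖e‖ ^ m) (𝓝 0))
    simpa [← pow_add, Nat.sub_add_cancel hmn] using this
  have hA3 : (fun e => addedArea xs (e + xR)) =O[𝓝 0] fun e : Plane => ‖e‖ ^ 3 := by
    have := (hA.trans (hpow 3 4 (by norm_num))).add
      (((planeCross_isBigO xs).pow 3).const_mul_left
        (2 / 3 * (1 / (‖xs‖ - ‖xR‖) - 1 / ‖xs‖) / ‖xR‖ ^ 3))
    exact this.congr_left fun e => by ring
  have hu : (fun e => lam * addedArea xs (e + xR)) =O[𝓝 0] fun e : Plane => ‖e‖ ^ 3 :=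
    hA3.const_mul_left lam
  have hu0 : Tendsto (fun e => lam * addedArea xs (e + xR)) (𝓝 0) (𝓝 0) := by
    refine hu.trans_tendsto ?_
    have : Continuous fun e : Plane => ‖e‖ ^ 3 := by fun_prop
    simpa using this.tendsto 0
  have h6 : (fun e : Plane => (‖e‖ ^ 3) ^ 2) =O[𝓝 0] fun e : Plane => ‖e‖ ^ 4 := by
    simpa [← pow_mul] using hpow 4 6 (by norm_num)
  have := (((one_sub_exp_isBigO hu0).trans (hu.pow 2)).trans h6).add (hA.const_mul_left lam)
  exact this.congr_left fun e => by ring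

/-! ### The angular average. -/

theorem integral_abs_sin_sub_pow_three (α : ℝ) :
    ∫ θ in (0 : ℝ)..(2 * Real.pi), |Real.sin (θ - α)| ^ 3 = 8 / 3 := by
  have hper : Function.Periodic (fun θ => |Real.sin θ| ^ 3) Real.pi := fun θ => by
    simp [Real.sin_add_pi]
  have hint : ∀ a b : ℝ, IntervalIntegrable (fun θ => |Real.sin θ| ^ 3) volume a b := fun a b =>
    Continuous.intervalIntegrable (by fun_prop) _ _
  have hpi : ∫ θ in (0 : ℝ)..(0 + Real.pi), |Real.sin θ| ^ 3 = 4 / 3 := by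
    have : ∫ θ in (0 : ℝ)..(0 + Real.pi), |Real.sin θ| ^ 3 =
        ∫ θ in (0 : ℝ)..Real.pi, Real.sin θ ^ 3 := by
      rw [zero_add]
      refine intervalIntegral.integral_congr fun θ hθ => ?_
      rw [uIcc_of_le Real.pi_pos.le] at hθ
      simp only [abs_of_nonneg (Real.sin_nonneg_of_mem_Icc hθ)]
    rw [this, integral_sin_pow_three]
    norm_num
  rw [intervalIntegral.integral_comp_sub_right (fun θ => |Real.sin θ| ^ 3),
    ← intervalIntegral.integral_add_adjacent_intervals (hint _ (0 - α + Real.pi)) (hint _ _),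
    show 2 * Real.pi - α = 0 - α + Real.pi + Real.pi by ring,
    hper.intervalIntegral_add_eq (0 - α) 0, hper.intervalIntegral_add_eq (0 - α + Real.pi) 0, hpi]
  norm_num

theorem norm_polarPoint (r θ : ℝ) : ‖polarPoint r θ‖ = |r| := by
  rw [← sq_eq_sq₀ (norm_nonneg _) (abs_nonneg _), plane_norm_sq, sq_abs]
  simp only [polarPoint, PiLp.toLp_apply, Matrix.cons_val_zero, Matrix.cons_val_one]
  linear_combination r ^ 2 * Real.sin_sq_add_cos_sq θ

theorem exists_planeCross_polarPoint (xs : Plane) :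
    ∃ α : ℝ, ∀ r θ : ℝ, planeCross xs (polarPoint r θ) = r * ‖xs‖ * Real.sin (θ - α) := by
  have hn : ‖(⟨xs 0, xs 1⟩ : ℂ)‖ = ‖xs‖ := by
    rw [← sq_eq_sq₀ (norm_nonneg _) (norm_nonneg _), plane_norm_sq, ← Complex.normSq_eq_norm_sq,
      Complex.normSq_mk]
    ring
  have hcos := Complex.norm_mul_cos_arg ⟨xs 0, xs 1⟩
  have hsin := Complex.norm_mul_sin_arg ⟨xs 0, xs 1⟩
  rw [hn] at hcos hsin
  refine ⟨Complex.arg ⟨xs 0, xs 1⟩, fun r θ => ?_⟩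
  simp only at hcos hsin
  simp only [planeCross, polarPoint, PiLp.toLp_apply, Matrix.cons_val_zero, Matrix.cons_val_one]
  rw [Real.sin_sub]
  linear_combination -(r * Real.sin θ) * hcos + r * Real.cos θ * hsin

theorem continuous_polarPoint (r : ℝ) : Continuous (polarPoint r) := by
  unfold polarPoint
  refine (PiLp.continuous_toLp 2 _).comp (continuous_pi fun i => ?_)
  fin_cases i
  · simp; fun_prop
  · simp; fun_prop

/-- The expansion in `e` holds on a full neighbourhood of `0`, hence uniformly in `θ` on small
circles, and may be integrated. -/
theorem angular_integral_isBigO {xs xR : Plane} {t : ℝ} (lam : ℝ) (hxs : xs ≠ 0) (ht0 : 0 < t)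
    (ht1 : t < 1) (hxR : xR = t • xs) :
    (fun r => 2 * Real.pi - (∫ θ in (0 : ℝ)..(2 * Real.pi),
        Real.exp (-(lam * addedArea xs (polarPoint r θ + xR)))) -
      lam * (16 / 9) * ((‖xs‖ / ‖xR‖) ^ 2 / (‖xs‖ - ‖xR‖)) * r ^ 3)
      =O[𝓝[≥] 0] fun r => r ^ 4 := by
  have hR : 0 < ‖xs‖ := norm_pos_iff.2 hxs
  have hs : ‖xR‖ = t * ‖xs‖ := by rw [hxR, norm_smul, Real.norm_eq_abs, abs_of_pos ht0]
  have hs0 : 0 < ‖xR‖ := by rw [hs]; positivity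
  have hsR : 0 < ‖xs‖ - ‖xR‖ := by rw [hs]; nlinarith
  obtain ⟨C, hC⟩ := (one_sub_exp_addedArea_isBigO lam hxs ht0 ht1 hxR).bound
  obtain ⟨δ, hδ, hball⟩ := Metric.eventually_nhds_iff.1 hC
  obtain ⟨α, hα⟩ := exists_planeCross_polarPoint xs
  set K := lam * (2 / 3 * (1 / (‖xs‖ - ‖xR‖) - 1 / ‖xs‖) / ‖xR‖ ^ 3) with hK
  refine IsBigO.of_bound (C * (2 * Real.pi)) ?_
  have hlt : ∀ᶠ r : ℝ in 𝓝[≥] 0, r < δ := nhdsWithin_le_nhds (eventually_lt_nhds hδ)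
  filter_upwards [self_mem_nhdsWithin, hlt] with r (hr0 : 0 ≤ r) hr
  have hcont : Continuous fun θ => Real.exp (-(lam * addedArea xs (polarPoint r θ + xR))) := by
    have := (continuous_addedArea xs).comp ((continuous_polarPoint r).add_const xR)
    exact Real.continuous_exp.comp (this.const_mul lam).neg
  have hcross : ∀ θ, |planeCross xs (polarPoint r θ)| ^ 3 =
      r ^ 3 * ‖xs‖ ^ 3 * |Real.sin (θ - α)| ^ 3 := by
    intro θ
    rw [hα, abs_mul, abs_mul, abs_of_nonneg hr0, abs_of_nonneg hR.le]; ring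
  -- The factor `16 / 9` is `2 / 3` from the lune times `8 / 3` from `|sin|^3`; moreover `1 / (‖xs‖
  -- - ‖xR‖) - 1 / ‖xs‖ = ‖xR‖ / (‖xs‖ * (‖xs‖ - ‖xR‖))`.
  have hsplit : ∫ θ in (0 : ℝ)..(2 * Real.pi),
      (1 - Real.exp (-(lam * addedArea xs (polarPoint r θ + xR))) -
        K * (r ^ 3 * ‖xs‖ ^ 3 * |Real.sin (θ - α)| ^ 3)) =
      2 * Real.pi - (∫ θ in (0 : ℝ)..(2 * Real.pi),
        Real.exp (-(lam * addedArea xs (polarPoint r θ + xR)))) -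
      lam * (16 / 9) * ((‖xs‖ / ‖xR‖) ^ 2 / (‖xs‖ - ‖xR‖)) * r ^ 3 := by
    rw [intervalIntegral.integral_sub
      (Continuous.intervalIntegrable (by fun_prop) _ _)
      (Continuous.intervalIntegrable (by fun_prop) _ _),
      intervalIntegral.integral_sub (by simp) (hcont.intervalIntegrable _ _),
      intervalIntegral.integral_const_mul, intervalIntegral.integral_const_mul,
      integral_abs_sin_sub_pow_three, intervalIntegral.integral_const, hK]
    simp only [smul_eq_mul]
    field_simp
    ring
  have hb := intervalIntegral.norm_integral_le_of_norm_le_const (a := 0) (b := 2 * Real.pi)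
    (f := fun θ => 1 - Real.exp (-(lam * addedArea xs (polarPoint r θ + xR))) -
        K * (r ^ 3 * ‖xs‖ ^ 3 * |Real.sin (θ - α)| ^ 3)) (C := C * r ^ 4) (fun θ _ => by
      have := hball (y := polarPoint r θ)
        (by rw [dist_zero_right, norm_polarPoint, abs_of_nonneg hr0]; exact hr)
      rw [hcross, norm_polarPoint, abs_of_nonneg hr0, Real.norm_of_nonneg (pow_nonneg hr0 4)]
        at this
      exact this)
  rw [hsplit, sub_zero, abs_of_pos Real.two_pi_pos] at hb
  rw [Real.norm_of_nonneg (pow_nonneg hr0 4)]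
  exact hb.trans (le_of_eq (by ring))

/-! ### Exact order and conclusion. -/

theorem isTheta_pow_of_sub_isBigO {f : ℝ → ℝ} {c : ℝ} (hc : c ≠ 0) {n : ℕ} {l : Filter ℝ}
    (hl : l ≤ 𝓝 0) (h : (fun r => f r - c * r ^ n) =O[l] fun r => r ^ (n + 1)) :
    f =Θ[l] fun r => r ^ n := by
  have ho : (fun r : ℝ => r ^ (n + 1)) =o[l] fun r => r ^ n := by
    have h1 : (fun r : ℝ => r) =o[l] fun _ => (1 : ℝ) :=
      (isLittleO_one_iff ℝ).2 hl
    have := (isBigO_refl (fun r : ℝ => r ^ n) l).mul_isLittleO h1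
    simpa [pow_succ] using this
  have hequiv : f ~[l] fun r => c * r ^ n := by
    have := h.trans_isLittleO ho
    exact this.trans_isBigO ((isBigO_const_mul_self c⁻¹ (fun r => c * r ^ n) l).congr_left
      fun r => by field_simp)
  exact hequiv.isTheta.trans ((isTheta_const_mul_left hc).2 isTheta_rfl)

theorem proposition6 {Ω : Type*} [MeasurableSpace Ω] (P : Measure Ω) [IsProbabilityMeasure P]
    (Φ : Ω → Set Plane) (lama lamu : ℝ) (hlama : 0 < lama) (hlamu : 0 < lamu)
    (hΦ : IsHomogeneousPPP P Φ lama)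
    (xs xR : Plane) (hxs : xs ≠ 0) (hxR : xR ∈ openSegment ℝ (0 : Plane) xs) :
    -- the conditional probabilities and the angular integrals below are well defined
    (∀ x, Tendsto (cellProbNear P Φ xs x) (𝓝[>] 0) (𝓝 (cellProb P Φ xs x))) ∧
    (∀ r, 0 ≤ r → IntervalIntegrable (fun θ => cellProb P Φ xs (polarPoint r θ + xR))
      volume 0 (2 * Real.pi)) ∧
    -- the expansion
    ((fun r => equivalentDensity P Φ lamu xs xR r -
        lamu * lama * (8 / (9 * Real.pi)) * ((‖xs‖ / ‖xR‖) ^ 2 / (‖xs‖ - ‖xR‖)) * r ^ 3)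
      =O[𝓝[≥] 0] fun r => r ^ 4) ∧
    -- the density is of exact order three
    ((fun r => equivalentDensity P Φ lamu xs xR r) =Θ[𝓝[≥] 0] fun r => r ^ 3) := by
  obtain ⟨a, t, ha, ht0, hat, hxt⟩ := hxR
  have ht1 : t < 1 := by linarith
  have hxt : xR = t • xs := by rw [← hxt, smul_zero, zero_add]
  have hcell : ∀ x, cellProb P Φ xs x = Real.exp (-(lama * addedArea xs x)) :=
    hΦ.cellProb_eq hlama xs
  have hR : 0 < ‖xs‖ := norm_pos_iff.2 hxs
  have hs : ‖xR‖ = t * ‖xs‖ := by rw [hxt, norm_smul, Real.norm_eq_abs, abs_of_pos ht0]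
  have hs0 : 0 < ‖xR‖ := by rw [hs]; positivity
  have hsR : 0 < ‖xs‖ - ‖xR‖ := by rw [hs]; nlinarith
  have hexp : (fun r => equivalentDensity P Φ lamu xs xR r -
        lamu * lama * (8 / (9 * Real.pi)) * ((‖xs‖ / ‖xR‖) ^ 2 / (‖xs‖ - ‖xR‖)) * r ^ 3)
      =O[𝓝[≥] 0] fun r => r ^ 4 := by
    refine ((angular_integral_isBigO lama hxs ht0 ht1 hxt).const_mul_left
      (lamu / (2 * Real.pi))).congr_left fun r => ?_
    simp only [equivalentDensity, hcell]
    have hpi := Real.pi_ne_zero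
    field_simp
    ring
  refine ⟨fun x => ?_, fun r _ => ?_, hexp, ?_⟩
  · rw [hΦ.cellProb_eq hlama]
    exact hΦ.tendsto_cellProbNear hlama xs x
  · simp only [hcell]
    have := (continuous_addedArea xs).comp ((continuous_polarPoint r).add_const xR)
    exact (Real.continuous_exp.comp (this.const_mul lama).neg).intervalIntegrable _ _
  · exact isTheta_pow_of_sub_isBigO (by positivity) nhdsWithin_le_nhds hexp
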